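/- Let $G$ be a finite simple graph with open neighbourhoods $N_G(v)$. An independent set $I$ of $G$ is \emph{nested} if its vertices can be linearly ordered so that $v\le u$ implies $N_G(u)\subseteq N_G(v)$. A \emph{nested colouring} of $G$ is a partition of $V(G)$ into nested independent sets, and the \emph{nested chromatic number} $\chi_N(G)$ is the least number of classes in a nested colouring of $G$. \textbf{Theorem.} The nested chromatic number of a finite simple graph on $n$ vertices can be computed in $O(n^3)$ time. That is, there are a function $T:\mathbb N\to\mathbb N$ with $T(n)=O(n^3)$ and a single program for the unit-cost word RAM with words of $O(\log n)$ bits which, for every $n$ and every graph $G$ on $n$ vertices given by its adjacency matrix, halts after at most $T(n)$ steps with output $\chi_N(G)$. -/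

import Mathlib

/-! ## Nested colourings -/

namespace NestedColouring

/-- `u` is a weak duplicate of `v` in `G`: the open neighbourhood of `u` is contained in that
of `v`. -/
def IsWeakDuplicate {V : Type*} (G : SimpleGraph V) (u v : V) : Prop :=
  G.neighborSet u ⊆ G.neighborSet v

/-- A nested independent set: an independent set whose vertices can be linearly ordered so that
`v ≤ u` implies that `u` is a weak duplicate of `v`. -/
def IsNestedIndepSet {V : Type*} (G : SimpleGraph V) (I : Set V) : Prop :=
  G.IsIndepSet I ∧
    ∃ o : LinearOrder I, ∀ v u : I, o.le v u → IsWeakDuplicate G (u : V) (v : V)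

/-- A nested colouring: a partition of the vertices into independent sets (a proper colouring,
`SimpleGraph.Partition`) all of whose colour classes are nested. -/
def IsNestedColouring {V : Type*} {G : SimpleGraph V} (P : G.Partition) : Prop :=
  ∀ C ∈ P.parts, IsNestedIndepSet G C

/-- The nested chromatic number of a finite graph: the least number of colour classes of a nested
colouring. -/
noncomputable def nestedChromaticNumber {V : Type*} [Finite V] (G : SimpleGraph V) : ℕ :=
  sInf {k : ℕ | ∃ P : G.Partition, IsNestedColouring P ∧ P.parts.ncard = k}

end NestedColouring

/-! ## A unit-cost word RAM with a step count

The machine has registers, a random access memory, and words of `w` bits, that is, natural numbers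
below `2 ^ w`. A program is a fixed finite text (it uses only finitely many registers). The basic
instructions are the usual ones: load a constant, copy, add, subtract, multiply, read and write the
memory cell whose address is in a register. Control flow is structured: sequencing, branching and
looping on a comparison of two registers. Every basic instruction and every evaluation of a
comparison takes one step. An instruction whose result does not fit into a word cannot be
executed, so a program that overflows has no run. -/

namespace WordRAM

/-- The contents of the registers and of the memory. -/
@[ext]
structure State where
  reg : ℕ → ℕ
  mem : ℕ → ℕ

/-- Put the value `v` into register `r`. -/
def State.setReg (σ : State) (r v : ℕ) : State :=
  { σ with reg := Function.update σ.reg r v }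

/-- Put the value `v` into the memory cell with address `a`. -/
def State.setMem (σ : State) (a v : ℕ) : State :=
  { σ with mem := Function.update σ.mem a v }

/-- Comparisons between two registers. -/
inductive Test where
  /-- register `r` is less than register `s` -/
  | lt (r s : ℕ)
  /-- register `r` is equal to register `s` -/
  | eq (r s : ℕ)

/-- The comparison is true in the given state. -/
def Test.Holds : Test → State → Prop
  | .lt r s, σ => σ.reg r < σ.reg s
  | .eq r s, σ => σ.reg r = σ.reg s

/-- Programs. The arguments `d`, `r`, `s` are names of registers. -/
inductive Program where
  /-- do nothing -/
  | skip
  /-- `d := k` for a constant `k` -/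
  | const (d k : ℕ)
  /-- `d := r` -/
  | copy (d r : ℕ)
  /-- `d := r + s` -/
  | add (d r s : ℕ)
  /-- `d := r - s`, and `d := 0` if `r < s` -/
  | sub (d r s : ℕ)
  /-- `d := r * s` -/
  | mul (d r s : ℕ)
  /-- `d := mem[r]` -/
  | load (d r : ℕ)
  /-- `mem[r] := s` -/
  | store (r s : ℕ)
  /-- run `p`, then `q` -/
  | seq (p q : Program)
  /-- if the comparison is true then run `p`, else run `q` -/
  | branch (b : Test) (p q : Program)
  /-- while the comparison is true, run `p` -/
  | loop (b : Test) (p : Program)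

/-- `Exec w p σ t τ`: on the machine with words of `w` bits, the program `p` started in state `σ`
halts after exactly `t` steps in state `τ`. -/
inductive Exec (w : ℕ) : Program → State → ℕ → State → Prop
  | skip (σ : State) : Exec w .skip σ 0 σ
  | const (σ : State) (d k : ℕ) (h : k < 2 ^ w) :
      Exec w (.const d k) σ 1 (σ.setReg d k)
  | copy (σ : State) (d r : ℕ) (h : σ.reg r < 2 ^ w) :
      Exec w (.copy d r) σ 1 (σ.setReg d (σ.reg r))
  | add (σ : State) (d r s : ℕ) (h : σ.reg r + σ.reg s < 2 ^ w) :
      Exec w (.add d r s) σ 1 (σ.setReg d (σ.reg r + σ.reg s))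
  | sub (σ : State) (d r s : ℕ) (h : σ.reg r - σ.reg s < 2 ^ w) :
      Exec w (.sub d r s) σ 1 (σ.setReg d (σ.reg r - σ.reg s))
  | mul (σ : State) (d r s : ℕ) (h : σ.reg r * σ.reg s < 2 ^ w) :
      Exec w (.mul d r s) σ 1 (σ.setReg d (σ.reg r * σ.reg s))
  | load (σ : State) (d r : ℕ) (ha : σ.reg r < 2 ^ w) (h : σ.mem (σ.reg r) < 2 ^ w) :
      Exec w (.load d r) σ 1 (σ.setReg d (σ.mem (σ.reg r)))
  | store (σ : State) (r s : ℕ) (ha : σ.reg r < 2 ^ w) (h : σ.reg s < 2 ^ w) :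
      Exec w (.store r s) σ 1 (σ.setMem (σ.reg r) (σ.reg s))
  | seq {p q : Program} {σ τ ρ : State} {t u : ℕ} (hp : Exec w p σ t τ) (hq : Exec w q τ u ρ) :
      Exec w (.seq p q) σ (t + u) ρ
  | branchTrue {b : Test} {p q : Program} {σ τ : State} {t : ℕ} (hb : b.Holds σ)
      (hp : Exec w p σ t τ) : Exec w (.branch b p q) σ (t + 1) τ
  | branchFalse {b : Test} {p q : Program} {σ τ : State} {t : ℕ} (hb : ¬ b.Holds σ)
      (hq : Exec w q σ t τ) : Exec w (.branch b p q) σ (t + 1) τ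
  | loopTrue {b : Test} {p : Program} {σ τ ρ : State} {t u : ℕ} (hb : b.Holds σ)
      (hp : Exec w p σ t τ) (hl : Exec w (.loop b p) τ u ρ) :
      Exec w (.loop b p) σ (t + 1 + u) ρ
  | loopFalse {b : Test} {p : Program} {σ : State} (hb : ¬ b.Holds σ) :
      Exec w (.loop b p) σ 1 σ

open Classical in
/-- The input state of a graph on the vertices `0, …, n - 1`: register `0` holds `n`, and the
memory holds the adjacency matrix row by row; everything else is `0`. -/
noncomputable def graphInput {n : ℕ} (G : SimpleGraph (Fin n)) : State where
  reg r := if r = 0 then n else 0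
  mem a := if ∃ i j : Fin n, a = (i : ℕ) * n + (j : ℕ) ∧ G.Adj i j then 1 else 0

/-- The numerical graph parameter `f` can be computed in time `T` on the word RAM: there is one
program, and one constant `c`, such that for every `n` and every graph `G` on `n` vertices, on the
machine with words of `c * (⌊log₂ n⌋ + 1)` bits (so `O(log n)` bits), the program started on the
adjacency matrix of `G` halts after at most `T n` steps with the value `f G` in register `0`. -/
def ComputableInTime (f : (n : ℕ) → SimpleGraph (Fin n) → ℕ) (T : ℕ → ℕ) : Prop :=
  ∃ (p : Program) (c : ℕ), ∀ (n : ℕ) (G : SimpleGraph (Fin n)),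
    ∃ (t : ℕ) (τ : State), t ≤ T n ∧
      Exec (c * (Nat.log 2 n + 1)) p (graphInput G) t τ ∧ τ.reg 0 = f n G

end WordRAM

/-! ### Nested colourings as chain covers. -/

namespace NestedColouring

/-! Comparability under inclusion of neighbourhoods already forces two vertices to be non-adjacent,
so nested colourings are exactly the partitions into chains of the inclusion preorder. Breaking ties
between duplicates by name gives a strict order, `nestedOrder`, and the problem becomes the
computation of a minimum chain cover, as in Dilworth's theorem.

A matching that sends vertices to larger vertices cuts the order into chains, one for each vertex
without a partner (`exists_nestedColouring_of_matching`), while every antichain is a lower bound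
(`IsNestedColouring.card_le`). Both certificates come from one auction. Vertices bid for a cheapest
larger vertex, each bid raises a price by one and evicts the previous holder, and a bidder that sees
only prices of at least `n` gives up. At the end the `c` bidders that gave up are the unmatched
vertices, and a price level that no vertex has yields an antichain of size at least `c`
(`AuctionInv.exists_antichain`). Hence `c` is the answer, without an appeal to Dilworth's theorem.

For the running time, testing all inclusions takes `n` steps for each of `n * n` pairs
(`runs_deficitMatrix`). Prices never exceed `n`, so the auction has at most `n * n + n` rounds, each
a single linear scan (`runs_auction`). -/

theorem IsNestedIndepSet.comparable {V : Type*} {G : SimpleGraph V} {I : Set V}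
    (h : IsNestedIndepSet G I) {u v : V} (hu : u ∈ I) (hv : v ∈ I) :
    IsWeakDuplicate G u v ∨ IsWeakDuplicate G v u := by
  obtain ⟨-, o, ho⟩ := h
  rcases o.le_total ⟨v, hv⟩ ⟨u, hu⟩ with h | h
  · exact Or.inl (ho _ _ h)
  · exact Or.inr (ho _ _ h)

/-- An edge between comparable vertices would put one of them into its own neighbourhood. For the
linear order, degree decides, since an inclusion between neighbourhoods of comparable vertices can
be read off from their sizes. -/
theorem IsNestedIndepSet.of_comparable {V : Type*} [Finite V] {G : SimpleGraph V} {I : Set V}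
    (h : ∀ u ∈ I, ∀ v ∈ I, IsWeakDuplicate G u v ∨ IsWeakDuplicate G v u) :
    IsNestedIndepSet G I := by
  refine ⟨?_, ?_⟩
  · intro u hu v hv _ huv
    rcases h u hu v hv with h | h
    · exact G.loopless.irrefl v (h huv)
    · exact G.loopless.irrefl u (h huv.symm)
  · obtain ⟨k, ⟨e⟩⟩ := Finite.exists_equiv_fin I
    -- Larger neighbourhoods must come first, hence the dual; the enumeration separates vertices of
    -- equal degree.
    let f : I → ℕᵒᵈ ×ₗ Fin k :=
      fun x => toLex (OrderDual.toDual (G.neighborSet (x : V)).ncard, e x)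
    have hf : Function.Injective f := by
      intro x y hxy
      have := congrArg (fun z => (ofLex z).2) hxy
      exact e.injective this
    refine ⟨LinearOrder.lift' f hf, fun v u hvu => ?_⟩
    have hle : (G.neighborSet (u : V)).ncard ≤ (G.neighborSet (v : V)).ncard := by
      have h1 : f v ≤ f u := hvu
      rcases Prod.Lex.le_iff.1 h1 with h2 | h2
      · exact le_of_lt h2
      · exact le_of_eq (congrArg OrderDual.ofDual h2.1).symm
    rcases h u u.2 v v.2 with h | h
    · exact h
    · exact (Set.eq_of_subset_of_ncard_le h hle (Set.toFinite _)).symm.subset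

/-- An antichain is a lower bound for the number of classes of a nested colouring. -/
theorem IsNestedColouring.card_le {V : Type*} [Finite V] {G : SimpleGraph V} {P : G.Partition}
    (hP : IsNestedColouring P) (A : Finset V)
    (hA : ∀ u ∈ A, ∀ v ∈ A, IsWeakDuplicate G u v → u = v) : A.card ≤ P.parts.ncard := by
  rw [← Set.ncard_coe_finset]
  refine Set.ncard_le_ncard_of_injOn P.partOfVertex (fun a _ => P.partOfVertex_mem a) ?_
    (Set.toFinite _)
  intro u hu v hv huv
  have h1 : u ∈ P.partOfVertex u := P.mem_partOfVertex u
  have h2 : v ∈ P.partOfVertex u := huv ▸ P.mem_partOfVertex v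
  rcases (hP _ (P.partOfVertex_mem u)).comparable h1 h2 with h | h
  · exact hA u hu v hv h
  · exact (hA v hv u hu h).symm

/-- A map all of whose fibres are chains bounds the nested chromatic number from above. -/
theorem nestedChromaticNumber_le {V : Type*} [Finite V] {G : SimpleGraph V} (F : Finset V)
    (f : V → V) (hf : ∀ v, f v ∈ F)
    (hc : ∀ u v, f u = f v → IsWeakDuplicate G u v ∨ IsWeakDuplicate G v u) :
    ∃ P : G.Partition, IsNestedColouring P ∧ P.parts.ncard ≤ F.card := by
  have hn : ∀ C ∈ (Setoid.ker f).classes, IsNestedIndepSet G C := by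
    rintro C ⟨y, rfl⟩
    refine IsNestedIndepSet.of_comparable fun u hu v hv => hc u v ?_
    have h1 : f u = f y := hu
    have h2 : f v = f y := hv
    rw [h1, h2]
  refine ⟨⟨(Setoid.ker f).classes, Setoid.isPartition_classes _, fun C hC => (hn C hC).1⟩, hn, ?_⟩
  have hs : (Setoid.ker f).classes ⊆ (fun y => {x | f x = y}) '' (F : Set V) := by
    rintro C ⟨y, rfl⟩
    exact ⟨f y, hf y, rfl⟩
  calc _ ≤ ((fun y => {x | f x = y}) '' (F : Set V)).ncard := Set.ncard_le_ncard hs (Set.toFinite _)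
    _ ≤ (F : Set V).ncard := Set.ncard_image_le (Set.toFinite _)
    _ = F.card := Set.ncard_coe_finset F

/-- A matching in a strict order contained in the weak-duplicate relation gives a nested colouring
with one class for each vertex outside the domain of the matching. -/
theorem exists_nestedColouring_of_matching {V : Type*} [Finite V] {G : SimpleGraph V}
    (R M : V → V → Prop) [IsStrictOrder V R] (hR : ∀ u v, R u v → IsWeakDuplicate G u v)
    (hM : ∀ u v, M u v → R u v) (hl : ∀ u u' v, M u v → M u' v → u = u')
    (F : Finset V) (hF : ∀ u, u ∈ F ∨ ∃ v, M u v) :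
    ∃ P : G.Partition, IsNestedColouring P ∧ P.parts.ncard ≤ F.card := by
  have htop : ∀ u, ∃ f ∈ F, Relation.ReflTransGen M u f := by
    intro u
    have hwf : WellFounded (Function.swap R) :=
      Finite.wellFounded_of_trans_of_irrefl (Function.swap R)
    induction u using hwf.induction with
    | _ u ih =>
      rcases hF u with h | ⟨v, hv⟩
      · exact ⟨u, h, .refl⟩
      · obtain ⟨f, hf, hvf⟩ := ih v (hM u v hv)
        exact ⟨f, hf, .head hv hvf⟩
  choose f hf hreach using htop
  have hdup : ∀ u v, Relation.ReflTransGen M u v → IsWeakDuplicate G u v := by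
    intro u v h
    induction h with
    | refl => exact subset_rfl
    | tail _ h ih => exact ih.trans (hR _ _ (hM _ _ h))
  refine nestedChromaticNumber_le F f hf fun u v huv => ?_
  have hu := Relation.reflTransGen_swap.2 (hreach u)
  have hv := Relation.reflTransGen_swap.2 (hreach v)
  rw [← huv] at hv
  -- Walking down from a common top, each vertex has at most one predecessor, so two vertices with
  -- the same top lie on one path.
  have hru : Relator.RightUnique (Function.swap M) := fun a b c hab hac => hl b c a hab hac
  rcases Relation.ReflTransGen.total_of_right_unique hru hu hv with h | h
  · exact Or.inr (hdup _ _ (Relation.reflTransGen_swap.1 h))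
  · exact Or.inl (hdup _ _ (Relation.reflTransGen_swap.1 h))

theorem nestedChromaticNumber_eq {V : Type*} [Finite V] {G : SimpleGraph V} {k : ℕ}
    (hle : ∃ P : G.Partition, IsNestedColouring P ∧ P.parts.ncard ≤ k)
    (A : Finset V) (hA : ∀ u ∈ A, ∀ v ∈ A, IsWeakDuplicate G u v → u = v) (hk : k ≤ A.card) :
    nestedChromaticNumber G = k := by
  obtain ⟨P, hP, hPk⟩ := hle
  have hle : nestedChromaticNumber G ≤ P.parts.ncard := Nat.sInf_le ⟨P, hP, rfl⟩
  refine le_antisymm (hle.trans hPk) ?_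
  have hne : {k : ℕ | ∃ P : G.Partition, IsNestedColouring P ∧ P.parts.ncard = k}.Nonempty :=
    ⟨_, P, hP, rfl⟩
  obtain ⟨Q, hQ, hQk⟩ := Nat.sInf_mem hne
  exact (hk.trans (hQ.card_le A hA)).trans hQk.le

end NestedColouring

/-! ### The auction and its two certificates. -/

namespace NestedColouring

/-- The invariant of the auction algorithm for a maximum matching of the relation `R` on the
numbers below `n`. The price of `v` is `d v`, the bidder holding `v` is `m v - 1` (nobody if
`m v = 0`), the next bidder to enter is `s + 1`, the current bidder is `u`, and `c` bidders have
given up. -/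
structure AuctionInv (n : ℕ) (R : ℕ → ℕ → Prop) (d m : ℕ → ℕ) (s u c : ℕ) : Prop where
  s_le : s ≤ n
  u_le : u ≤ s
  -- Once everybody has entered, the current bidder is the dummy `n`, so that every actual vertex
  -- has either given up or holds something.
  u_eq : s = n → u = n
  price_le : ∀ v < n, d v ≤ n
  price_free : ∀ v < n, m v = 0 → d v = 0
  rel : ∀ v < n, ∀ x, m v = x + 1 → x < n ∧ R x v
  -- Approximate complementary slackness: the holder chose a cheapest vertex, and its own bid then
  -- added one. Other prices can only grow afterwards.
  price_rel : ∀ v < n, ∀ x, m v = x + 1 → ∀ w < n, R x w → d v ≤ d w + 1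
  inj : ∀ v < n, ∀ v' < n, ∀ x, m v = x + 1 → m v' = x + 1 → v = v'
  exists_failed : ∃ F : Finset ℕ, F.card = c ∧
    (∀ f ∈ F, f < n ∧ (∀ v < n, m v ≠ f + 1) ∧ ∀ w < n, R f w → n ≤ d w) ∧
    ∀ x < n, (x ∈ F ∨ ∃ v < n, m v = x + 1) ↔ x ≤ s ∧ x ≠ u

/-- The number of steps that the auction can still take. -/
def auctionPotential (n : ℕ) (d : ℕ → ℕ) (s : ℕ) : ℕ :=
  ∑ v ∈ Finset.range n, (n - d v) + (n - s)

theorem auctionPotential_lt_of_bid {n : ℕ} {d d' : ℕ → ℕ} {s s' v : ℕ} (hs : s ≤ s')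
    (hv : v < n) (hd : d v < n) (hd' : ∀ w < n, d' w = if w = v then d v + 1 else d w) :
    auctionPotential n d' s' < auctionPotential n d s := by
  unfold auctionPotential
  refine add_lt_add_of_lt_of_le (Finset.sum_lt_sum ?_ ⟨v, Finset.mem_range.2 hv, ?_⟩) (by omega)
  · intro w hw
    rw [hd' w (Finset.mem_range.1 hw)]
    split_ifs with h
    · subst h; omega
    · exact le_rfl
  · rw [hd' v hv, if_pos rfl]; omega

namespace AuctionInv

variable {n : ℕ} {R : ℕ → ℕ → Prop} {d m d' m' : ℕ → ℕ} {s u c v : ℕ}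

theorem init (n : ℕ) (R : ℕ → ℕ → Prop) : AuctionInv n R (fun _ => 0) (fun _ => 0) 0 0 0 where
  s_le := Nat.zero_le n
  u_le := le_rfl
  u_eq := id
  price_le := by simp
  price_free := by simp
  rel := by simp
  price_rel := by simp
  inj := by simp
  exists_failed := ⟨∅, by simp⟩

/-- The current bidder gives up. -/
theorem fail (h : AuctionInv n R d m s u c) (hs : s < n)
    (hu : ∀ w < n, R u w → n ≤ d w) : AuctionInv n R d m (s + 1) (s + 1) (c + 1) := by
  obtain ⟨F, hc, hF, hb⟩ := h.exists_failed
  have hus := h.u_le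
  have hbu := hb u (by omega)
  have huF : u ∉ F := fun h' => (hbu.1 (Or.inl h')).2 rfl
  have hum : ∀ v < n, m v ≠ u + 1 := fun v hv h' => (hbu.1 (Or.inr ⟨v, hv, h'⟩)).2 rfl
  refine ⟨hs, le_rfl, id, h.price_le, h.price_free, h.rel, h.price_rel, h.inj,
    insert u F, by rw [Finset.card_insert_of_notMem huF, hc], ?_, ?_⟩
  · intro f hf
    rcases Finset.mem_insert.1 hf with rfl | hf
    · exact ⟨by omega, hum, hu⟩
    · exact hF f hf
  · intro x hx
    rw [Finset.mem_insert, or_assoc, hb x hx]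
    omega

/-- The current bidder `u` takes `v`; the last hypothesis says who bids next. -/
theorem bid {s' u' : ℕ} (h : AuctionInv n R d m s u c) (hs : s < n) (hv : v < n) (huv : R u v)
    (hd : d v < n) (hmin : ∀ w < n, R u w → d v ≤ d w)
    (hd' : ∀ w < n, d' w = if w = v then d v + 1 else d w)
    (hm' : ∀ w < n, m' w = if w = v then u + 1 else m w)
    (hnext : m v = 0 ∧ s' = s + 1 ∧ u' = s + 1 ∨ m v = u' + 1 ∧ s' = s) :
    AuctionInv n R d' m' s' u' c := by
  obtain ⟨F, hc, hF, hb⟩ := h.exists_failed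
  have hus := h.u_le
  have hbu := hb u (by omega)
  have huF : u ∉ F := fun h' => (hbu.1 (Or.inl h')).2 rfl
  have hum : ∀ v < n, m v ≠ u + 1 := fun v hv h' => (hbu.1 (Or.inr ⟨v, hv, h'⟩)).2 rfl
  have hle : ∀ w < n, d w ≤ d' w := by
    intro w hw
    rw [hd' w hw]
    split_ifs with hwv
    · subst hwv; omega
    · exact le_rfl
  have hu' : m v = u' + 1 → u' < n ∧ u' ≤ s ∧ u' ≠ u := fun h' => by
    have h1 := (h.rel v hv u' h').1
    exact ⟨h1, (hb u' h1).1 (Or.inr ⟨v, hv, h'⟩)⟩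
  refine ⟨by omega, by omega, by omega, ?_, ?_, ?_, ?_, ?_, F, hc, ?_, ?_⟩
  · intro w hw
    rw [hd' w hw]
    split_ifs
    · exact hd
    · exact h.price_le w hw
  · intro w hw
    rw [hd' w hw, hm' w hw]
    split_ifs
    · simp
    · exact h.price_free w hw
  · intro w hw x
    rw [hm' w hw]
    split_ifs with hwv
    · intro hx
      obtain rfl : u = x := by omega
      subst hwv
      exact ⟨by omega, huv⟩
    · exact h.rel w hw x
  · intro w hw x
    rw [hm' w hw, hd' w hw]
    split_ifs with hwv
    · intro hx z hz hxz
      obtain rfl : u = x := by omega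
      -- The new holder bought at the minimum price, and this is where the slack of one arises.
      exact Nat.add_le_add_right ((hmin z hz hxz).trans (hle z hz)) 1
    · intro hx z hz hxz
      exact (h.price_rel w hw x hx z hz hxz).trans (Nat.add_le_add_right (hle z hz) 1)
  · intro w hw w' hw' x
    rw [hm' w hw, hm' w' hw']
    split_ifs with h1 h2 h2
    · intros; omega
    · intro h3 h4
      exact absurd (h4.trans h3.symm) (hum w' hw')
    · intro h3 h4
      exact absurd (h3.trans h4.symm) (hum w hw)
    · exact h.inj w hw w' hw' x
  · intro f hf
    refine ⟨(hF f hf).1, ?_, fun w hw hfw => ((hF f hf).2.2 w hw hfw).trans (hle w hw)⟩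
    intro w hw
    rw [hm' w hw]
    split_ifs with hwv
    · rintro h1
      obtain rfl : u = f := by omega
      exact huF hf
    · exact (hF f hf).2.1 w hw
  · intro x hx
    -- The set of holders gains the bidder and loses the former holder of `v`, who held nothing else
    -- by injectivity.
    have hex : (∃ w < n, m' w = x + 1) ↔ x = u ∨ ((∃ w < n, m w = x + 1) ∧ m v ≠ x + 1) := by
      constructor
      · rintro ⟨w, hw, h1⟩
        rw [hm' w hw] at h1
        split_ifs at h1 with hwv
        · left; omega
        · exact Or.inr ⟨⟨w, hw, h1⟩, fun h2 => hwv (h.inj w hw v hv x h1 h2)⟩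
      · rintro (rfl | ⟨⟨w, hw, h1⟩, h2⟩)
        · exact ⟨v, hv, by rw [hm' v hv, if_pos rfl]⟩
        · refine ⟨w, hw, ?_⟩
          rw [hm' w hw, if_neg, h1]
          rintro rfl
          exact h2 h1
    have hbx := hb x hx
    have hxF : x ∈ F → m v ≠ x + 1 := fun hxF => (hF x hxF).2.1 v hv
    rw [hex]
    by_cases hvx : m v = x + 1
    · have h1 := hbx.1 (Or.inr ⟨v, hv, hvx⟩)
      have h2 : x ∉ F := fun h' => hxF h' hvx
      simp only [h2, hvx, ne_eq, not_true_eq_false, and_false, or_false, false_or]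
      clear hex hbx hb hbu
      omega
    · simp only [hvx, ne_eq, not_false_eq_true, and_true]
      rw [or_left_comm, hbx]
      clear hex hbx hb hbu
      omega

end AuctionInv

/-- The price of a value that some prices skip separates the vertices into two parts; the bidders
that gave up together with those holding a vertex above the gap outnumber the vertices above it by
`c` and can bid only there. -/
theorem AuctionInv.exists_antichain {n : ℕ} {R : ℕ → ℕ → Prop} {d m : ℕ → ℕ} {u c : ℕ}
    (h : AuctionInv n R d m n u c) :
    ∃ A : Finset ℕ, (∀ x ∈ A, x < n) ∧ (∀ x ∈ A, ∀ y ∈ A, ¬ R x y) ∧ c ≤ A.card := by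
  obtain ⟨F, hc, hF, hb⟩ := h.exists_failed
  -- There are `n` vertices but `n + 1` levels from `0` to `n`, so some level is not a price.
  obtain ⟨l, hl, hgap⟩ : ∃ l ∈ Finset.range (n + 1), l ∉ (Finset.range n).image d := by
    refine Finset.exists_mem_notMem_of_card_lt_card ?_
    calc _ ≤ (Finset.range n).card := Finset.card_image_le
      _ < _ := by simp
  have hln : l ≤ n := Nat.lt_succ_iff.1 (Finset.mem_range.1 hl)
  have hgap' : ∀ v < n, d v ≠ l := fun v hv hvl =>
    hgap (Finset.mem_image.2 ⟨v, Finset.mem_range.2 hv, hvl⟩)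
  let D := (Finset.range n).filter fun v => l < d v
  have hD : ∀ v ∈ D, v < n ∧ l < d v := fun v hv => by simpa [D] using hv
  have hDm : ∀ v ∈ D, m v = (m v - 1) + 1 := by
    intro v hv
    obtain ⟨h1, h2⟩ := hD v hv
    have : m v ≠ 0 := fun h0 => by have := h.price_free v h1 h0; omega
    omega
  let E := D.image fun v => m v - 1
  have hE : E.card = D.card := by
    refine Finset.card_image_of_injOn fun v hv w hw hvw => ?_
    have hvw : m v - 1 = m w - 1 := hvw
    exact h.inj v (hD v hv).1 w (hD w hw).1 _ (hDm v hv) (hvw ▸ hDm w hw)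
  have hdisj : Disjoint F E := by
    rw [Finset.disjoint_left]
    intro x hx hxE
    obtain ⟨v, hv, rfl⟩ := Finset.mem_image.1 hxE
    exact (hF _ hx).2.1 v (hD v hv).1 (hDm v hv)
  -- A bidder that gave up sees only prices at least `n ≥ l`; a holder of a vertex priced above `l`
  -- sees only prices at least `l`. As `l` is skipped, both see only prices above `l`.
  have hrel : ∀ x ∈ F ∪ E, x < n ∧ ∀ w < n, R x w → w ∈ D := by
    intro x hx
    rcases Finset.mem_union.1 hx with hx | hx
    · refine ⟨(hF x hx).1, fun w hw hxw => ?_⟩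
      have h1 := (hF x hx).2.2 w hw hxw
      have h2 := hgap' w hw
      simp only [D, Finset.mem_filter, Finset.mem_range]
      omega
    · obtain ⟨v, hv, rfl⟩ := Finset.mem_image.1 hx
      refine ⟨(h.rel v (hD v hv).1 _ (hDm v hv)).1, fun w hw hxw => ?_⟩
      have h1 := h.price_rel v (hD v hv).1 _ (hDm v hv) w hw hxw
      have h2 := hgap' w hw
      have h3 := (hD v hv).2
      simp only [D, Finset.mem_filter, Finset.mem_range]
      omega
  refine ⟨(F ∪ E) \ D, fun x hx => (hrel x (Finset.mem_sdiff.1 hx).1).1, ?_, ?_⟩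
  · intro x hx y hy hxy
    obtain ⟨hy1, hy2⟩ := Finset.mem_sdiff.1 hy
    exact hy2 ((hrel x (Finset.mem_sdiff.1 hx).1).2 y (hrel y hy1).1 hxy)
  · have h1 := Finset.le_card_sdiff D (F ∪ E)
    rw [Finset.card_union_of_disjoint hdisj] at h1
    omega

/-! ### From the auction to the nested chromatic number. -/

/-- The relation that orders the vertices by inclusion of neighbourhoods, duplicates being ordered
by their names. -/
def nestedOrder {n : ℕ} (G : SimpleGraph (Fin n)) (u v : Fin n) : Prop :=
  IsWeakDuplicate G u v ∧ (¬ IsWeakDuplicate G v u ∨ u < v)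

/-- For transitivity, if the two ends are duplicates then all three vertices are, and both
comparisons were decided by name. -/
instance {n : ℕ} (G : SimpleGraph (Fin n)) : IsStrictOrder (Fin n) (nestedOrder G) where
  irrefl u h := h.2.elim (fun h' => h' h.1) (lt_irrefl u)
  trans u v w h1 h2 := by
    refine ⟨h1.1.trans h2.1, ?_⟩
    by_cases hwu : IsWeakDuplicate G w u
    · have h3 : u < v := h1.2.resolve_left fun h => h (h2.1.trans hwu)
      have h4 : v < w := h2.2.resolve_left fun h => h (hwu.trans h1.1)
      exact Or.inr (h3.trans h4)
    · exact Or.inl hwu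

/-- When the auction is over, the number of bidders that gave up is the nested chromatic number. -/
theorem AuctionInv.nestedChromaticNumber_eq {n : ℕ} {R : ℕ → ℕ → Prop} {d m : ℕ → ℕ} {u c : ℕ}
    {G : SimpleGraph (Fin n)} (hR : ∀ x y : Fin n, R x y ↔ nestedOrder G x y)
    (h : AuctionInv n R d m n u c) : nestedChromaticNumber G = c := by
  obtain ⟨A, hAn, hA, hcA⟩ := h.exists_antichain
  obtain ⟨F, hc, hF, hb⟩ := h.exists_failed
  have hfin : ∀ S : Finset ℕ, (∀ x ∈ S, x < n) →
      (Finset.univ.filter fun x : Fin n => (x : ℕ) ∈ S).card = S.card := by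
    intro S hS
    refine Finset.card_bij (fun x _ => (x : ℕ)) ?_ ?_ ?_
    · intro x hx; simpa using hx
    · intro x _ y _ hxy; exact Fin.ext hxy
    · intro x hx; exact ⟨⟨x, hS x hx⟩, by simpa using hx, rfl⟩
  refine NestedColouring.nestedChromaticNumber_eq ?_
    (Finset.univ.filter fun x : Fin n => (x : ℕ) ∈ A) ?_ ?_
  · rw [← hc, ← hfin F fun x hx => (hF x hx).1]
    refine exists_nestedColouring_of_matching (nestedOrder G) (fun x y => m y = (x : ℕ) + 1)
      (fun _ _ h => h.1) ?_ ?_ _ ?_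
    · intro x y hxy
      exact (hR x y).1 (h.rel y y.2 x hxy).2
    · intro x x' y h1 h2
      exact Fin.ext (by omega)
    · intro x
      have hx := x.2
      have hu := h.u_eq rfl
      rcases (hb x hx).2 (by omega) with h1 | ⟨v, hv, h1⟩
      · exact Or.inl (by simpa using h1)
      · exact Or.inr ⟨⟨v, hv⟩, h1⟩
  · intro x hx y hy hxy
    simp only [Finset.mem_filter, Finset.mem_univ, true_and] at hx hy
    have h1 := fun h' => hA x hx y hy ((hR x y).2 h')
    have h2 := fun h' => hA y hy x hx ((hR y x).2 h')
    -- The tie-break makes any two distinct vertices with nested neighbourhoods related in one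
    -- direction, which the antichain forbids.
    by_contra hne
    rcases lt_or_gt_of_ne hne with hlt | hlt
    · exact h1 ⟨hxy, Or.inr hlt⟩
    · by_cases hyx : IsWeakDuplicate G y x
      · exact h2 ⟨hyx, Or.inr hlt⟩
      · exact h1 ⟨hxy, Or.inl hyx⟩
  · rwa [hfin A hAn]

end NestedColouring

/-! ### Proof rules for the word RAM. -/

namespace WordRAM

/-- From the state `σ` the program halts within `T` steps in a state satisfying `Q`. -/
def Runs (w : ℕ) (p : Program) (σ : State) (T : ℕ) (Q : State → Prop) : Prop :=
  ∃ t τ, t ≤ T ∧ Exec w p σ t τ ∧ Q τ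

@[simp] theorem State.reg_setReg (σ : State) (r v s : ℕ) :
    (σ.setReg r v).reg s = if s = r then v else σ.reg s := by
  simp [State.setReg, Function.update_apply]

@[simp] theorem State.mem_setReg (σ : State) (r v : ℕ) : (σ.setReg r v).mem = σ.mem := rfl

@[simp] theorem State.reg_setMem (σ : State) (a v : ℕ) : (σ.setMem a v).reg = σ.reg := rfl

@[simp] theorem State.mem_setMem (σ : State) (a v b : ℕ) :
    (σ.setMem a v).mem b = if b = a then v else σ.mem b := by
  simp [State.setMem, Function.update_apply]

namespace Runs

variable {w : ℕ} {σ : State} {T : ℕ} {Q : State → Prop} {p q : Program}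

theorem mono {T' : ℕ} {Q' : State → Prop} (h : Runs w p σ T Q) (hT : T ≤ T')
    (hQ : ∀ τ, Q τ → Q' τ) : Runs w p σ T' Q' := by
  obtain ⟨t, τ, ht, he, hq⟩ := h
  exact ⟨t, τ, ht.trans hT, he, hQ τ hq⟩

theorem skip (h : Q σ) : Runs w .skip σ T Q := ⟨0, σ, Nat.zero_le _, .skip σ, h⟩

theorem seq {T₁ T₂ : ℕ} (h : Runs w p σ T₁ fun τ => Runs w q τ T₂ Q) :
    Runs w (.seq p q) σ (T₁ + T₂) Q := by
  obtain ⟨t, τ, ht, he, u, ρ, hu, he', hq⟩ := h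
  exact ⟨t + u, ρ, Nat.add_le_add ht hu, .seq he he', hq⟩

theorem step {τ : State} (he : Exec w p σ 1 τ) (h : Runs w q τ T Q) :
    Runs w (.seq p q) σ (T + 1) Q := by
  obtain ⟨t, ρ, ht, he', hq⟩ := h
  exact ⟨1 + t, ρ, by omega, .seq he he', hq⟩

theorem const {d k : ℕ} (h : k < 2 ^ w) (hq : Runs w q (σ.setReg d k) T Q) :
    Runs w (.seq (.const d k) q) σ (T + 1) Q :=
  step (.const σ d k h) hq

/-- Naming the value by a separate equation keeps symbolic states in closed form instead of
accumulating nested register reads; the next rules have the same shape. -/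
theorem copy {d r : ℕ} (x : ℕ) (hx : σ.reg r = x) (h : x < 2 ^ w)
    (hq : Runs w q (σ.setReg d x) T Q) : Runs w (.seq (.copy d r) q) σ (T + 1) Q := by
  subst hx
  exact step (.copy σ d r h) hq

theorem add {d r s : ℕ} (x : ℕ) (hx : σ.reg r + σ.reg s = x) (h : x < 2 ^ w)
    (hq : Runs w q (σ.setReg d x) T Q) : Runs w (.seq (.add d r s) q) σ (T + 1) Q := by
  subst hx
  exact step (.add σ d r s h) hq

theorem sub {d r s : ℕ} (x : ℕ) (hx : σ.reg r - σ.reg s = x) (h : x < 2 ^ w)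
    (hq : Runs w q (σ.setReg d x) T Q) : Runs w (.seq (.sub d r s) q) σ (T + 1) Q := by
  subst hx
  exact step (.sub σ d r s h) hq

theorem mul {d r s : ℕ} (x : ℕ) (hx : σ.reg r * σ.reg s = x) (h : x < 2 ^ w)
    (hq : Runs w q (σ.setReg d x) T Q) : Runs w (.seq (.mul d r s) q) σ (T + 1) Q := by
  subst hx
  exact step (.mul σ d r s h) hq

theorem load {d r : ℕ} (a x : ℕ) (ha : σ.reg r = a) (hx : σ.mem a = x) (hla : a < 2 ^ w)
    (h : x < 2 ^ w) (hq : Runs w q (σ.setReg d x) T Q) :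
    Runs w (.seq (.load d r) q) σ (T + 1) Q := by
  subst hx ha
  exact step (.load σ d r hla h) hq

theorem store {r s : ℕ} (a x : ℕ) (ha : σ.reg r = a) (hx : σ.reg s = x) (hla : a < 2 ^ w)
    (h : x < 2 ^ w) (hq : Runs w q (σ.setMem a x) T Q) :
    Runs w (.seq (.store r s) q) σ (T + 1) Q := by
  subst hx ha
  exact step (.store σ r s hla h) hq

theorem branch {b : Test} (ht : b.Holds σ → Runs w p σ T Q) (hf : ¬ b.Holds σ → Runs w q σ T Q) :
    Runs w (.branch b p q) σ (T + 1) Q := by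
  by_cases hb : b.Holds σ
  · obtain ⟨t, τ, h, he, hq⟩ := ht hb
    exact ⟨t + 1, τ, by omega, .branchTrue hb he, hq⟩
  · obtain ⟨t, τ, h, he, hq⟩ := hf hb
    exact ⟨t + 1, τ, by omega, .branchFalse hb he, hq⟩

/-- The rule for loops, with an invariant `I`, a variant `μ` and a bound `C` for the body. -/
theorem loop {b : Test} (I : State → Prop) (μ : State → ℕ) (C : ℕ) (h0 : I σ)
    (hstep : ∀ τ, I τ → b.Holds τ → Runs w p τ C fun ρ => I ρ ∧ μ ρ < μ τ)
    (hT : μ σ * (C + 1) + 1 ≤ T) (hQ : ∀ τ, I τ → ¬ b.Holds τ → Q τ) :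
    Runs w (.loop b p) σ T Q := by
  suffices H : ∀ k σ, μ σ ≤ k → I σ → Runs w (.loop b p) σ (k * (C + 1) + 1) Q from
    (H (μ σ) σ le_rfl h0).mono hT fun _ h => h
  intro k
  induction k with
  | zero =>
    intro σ hk h0
    by_cases hb : b.Holds σ
    · obtain ⟨t, τ, ht, he, -, hlt⟩ := hstep σ h0 hb
      omega
    · exact ⟨1, σ, by omega, .loopFalse hb, hQ σ h0 hb⟩
  | succ k ih =>
    intro σ hk h0
    by_cases hb : b.Holds σ
    · obtain ⟨t, τ, ht, he, hI, hlt⟩ := hstep σ h0 hb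
      obtain ⟨u, ρ, hu, he', hq⟩ := ih τ (by omega) hI
      refine ⟨t + 1 + u, ρ, ?_, .loopTrue hb he he', hq⟩
      have := Nat.succ_mul k (C + 1)
      rw [Nat.succ_eq_add_one] at this
      omega
    · exact ⟨1, σ, by omega, .loopFalse hb, hQ σ h0 hb⟩

end Runs

/-! ### Tabulating the neighbourhood inclusions. -/

theorem index_lt {n i k : ℕ} (hi : i < n) (hk : k < n) : i * n + k < n * n := by
  nlinarith [Nat.mul_le_mul_right n (Nat.succ_le_of_lt hi)]

/-- The number of columns in which row `i` of the matrix exceeds row `j`. -/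
def deficit (A : ℕ → ℕ) (n i j : ℕ) : ℕ :=
  ∑ k ∈ Finset.range n, (A (i * n + k) - A (j * n + k))

theorem deficit_le {A : ℕ → ℕ} (hA : ∀ a, A a ≤ 1) (n i j : ℕ) : deficit A n i j ≤ n := by
  refine (Finset.sum_le_card_nsmul (Finset.range n) _ 1 fun k _ => ?_).trans (by simp)
  exact (Nat.sub_le _ _).trans (hA _)

open Program

/-- Put the deficit of the two rows whose base addresses are in registers 6 and 7 into
register 9. -/
def deficitLoop : Program :=
  loop (.lt 8 0) <|
    seq (add 10 6 8) <| seq (load 10 10) <| seq (add 11 7 8) <| seq (load 11 11) <|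
    seq (sub 10 10 11) <| seq (add 9 9 10) <| seq (add 8 8 1) skip

/-- Each round costs seven instructions and one test. The word bound `hW` is shared by all routines:
addresses stay below `2 * n * n + 2 * n`, and it leaves room for all intermediate values. -/
theorem runs_deficitLoop {w n i j : ℕ} {A : ℕ → ℕ} {σ : State} (hA : ∀ a, A a ≤ 1)
    (hW : 4 * (n * n) + 4 * n + 4 < 2 ^ w) (hi : i < n) (hj : j < n)
    (h0 : σ.reg 0 = n) (h1 : σ.reg 1 = 1) (h6 : σ.reg 6 = i * n) (h7 : σ.reg 7 = j * n)
    (h8 : σ.reg 8 = 0) (h9 : σ.reg 9 = 0) (hmem : ∀ a < n * n, σ.mem a = A a) :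
    Runs w deficitLoop σ (8 * n + 1) fun τ => τ.mem = σ.mem ∧ τ.reg 9 = deficit A n i j ∧
      ∀ r, r ≠ 8 → r ≠ 9 → r ≠ 10 → r ≠ 11 → τ.reg r = σ.reg r := by
  refine Runs.loop (fun τ => τ.mem = σ.mem ∧ τ.reg 8 ≤ n ∧
      τ.reg 9 = (∑ k ∈ Finset.range (τ.reg 8), (A (i * n + k) - A (j * n + k))) ∧
      ∀ r, r ≠ 8 → r ≠ 9 → r ≠ 10 → r ≠ 11 → τ.reg r = σ.reg r)
    (fun τ => n - τ.reg 8) 7 ⟨rfl, by simp [h8], by simp [h8, h9], fun _ _ _ _ _ => rfl⟩ ?_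
    (by simp only [h8]; omega) ?_
  · rintro τ ⟨hm, hk, hs, hr⟩ hb
    have hb : τ.reg 8 < τ.reg 0 := hb
    have e0 : τ.reg 0 = n := by rw [hr 0 (by simp) (by simp) (by simp) (by simp), h0]
    have e1 : τ.reg 1 = 1 := by rw [hr 1 (by simp) (by simp) (by simp) (by simp), h1]
    have e6 : τ.reg 6 = i * n := by rw [hr 6 (by simp) (by simp) (by simp) (by simp), h6]
    have e7 : τ.reg 7 = j * n := by rw [hr 7 (by simp) (by simp) (by simp) (by simp), h7]
    obtain ⟨k, e8⟩ : ∃ k, τ.reg 8 = k := ⟨_, rfl⟩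
    rw [e8] at hs hk
    rw [e8, e0] at hb
    have hik := index_lt hi hb
    have hjk := index_lt hj hb
    have hAi := hA (i * n + k)
    have hAj := hA (j * n + k)
    have hsum : (∑ k ∈ Finset.range k, (A (i * n + k) - A (j * n + k))) ≤ k := by
      refine (Finset.sum_le_card_nsmul (Finset.range k) _ 1 fun k _ => ?_).trans (by simp)
      exact (Nat.sub_le _ _).trans (hA _)
    refine Runs.add (i * n + k) (by simp [e6, e8]) (by omega) ?_
    refine Runs.load (i * n + k) (A (i * n + k)) (by simp) (by simp [hm, hmem _ hik])
      (by omega) (by omega) ?_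
    refine Runs.add (j * n + k) (by simp [e7, e8]) (by omega) ?_
    refine Runs.load (j * n + k) (A (j * n + k)) (by simp) (by simp [hm, hmem _ hjk])
      (by omega) (by omega) ?_
    refine Runs.sub (A (i * n + k) - A (j * n + k)) (by simp) (by omega) ?_
    refine Runs.add (∑ k ∈ Finset.range (k + 1), (A (i * n + k) - A (j * n + k)))
      (by simp [hs, Finset.sum_range_succ]) (by rw [Finset.sum_range_succ]; omega) ?_
    refine Runs.add (k + 1) (by simp [e8, e1]) (by omega) ?_
    refine Runs.skip ⟨⟨by simp [hm], by simp; omega, by simp, ?_⟩, by simp [e8]; omega⟩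
    intro r r8 r9 r10 r11
    simp [r8, r9, r10, r11, hr]
  · rintro τ ⟨hm, hk, hs, hr⟩ hb
    have hb : ¬ τ.reg 8 < τ.reg 0 := hb
    rw [hr 0 (by simp) (by simp) (by simp) (by simp), h0] at hb
    obtain hk : τ.reg 8 = n := by omega
    exact ⟨hm, by rw [hs, hk, deficit], hr⟩

/-- Write the matrix of all deficits behind the adjacency matrix. -/
def deficitMatrix : Program :=
  loop (.lt 12 3) <|
    seq (const 9 0) <| seq (const 8 0) <| seq deficitLoop <|
    seq (add 10 3 12) <| seq (store 10 9) <| seq (add 12 12 1) <| seq (add 7 7 0) <|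
    branch (.eq 7 3) (seq (const 7 0) <| seq (add 6 6 0) skip) skip

theorem runs_deficitMatrix {w n : ℕ} {A : ℕ → ℕ} {σ : State} (hA : ∀ a, A a ≤ 1)
    (hW : 4 * (n * n) + 4 * n + 4 < 2 ^ w)
    (h0 : σ.reg 0 = n) (h1 : σ.reg 1 = 1) (h3 : σ.reg 3 = n * n) (h6 : σ.reg 6 = 0)
    (h7 : σ.reg 7 = 0) (h12 : σ.reg 12 = 0) (hmem : ∀ a < n * n, σ.mem a = A a)
    (hz : ∀ a, n * n ≤ a → σ.mem a = 0) :
    Runs w deficitMatrix σ (n * n * (8 * n + 11) + 1) fun τ =>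
      (∀ i < n, ∀ j < n, τ.mem (n * n + (i * n + j)) = deficit A n i j) ∧
      (∀ a, n * n + n * n ≤ a → τ.mem a = 0) ∧
      ∀ r, r < 6 ∨ 12 < r → τ.reg r = σ.reg r := by
  refine Runs.loop (fun τ => (∀ a < n * n, τ.mem a = A a) ∧
      (∀ i < n, ∀ j < n, i * n + j < τ.reg 12 → τ.mem (n * n + (i * n + j)) = deficit A n i j) ∧
      (∀ a, n * n + n * n ≤ a → τ.mem a = 0) ∧
      -- The machine keeps both row bases, so it never divides. The guard on `j < n` is there for `n
      -- = 0`, where the initial `j = 0` violates it.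
      (∃ i j, τ.reg 12 = i * n + j ∧ (τ.reg 12 < n * n → j < n) ∧ τ.reg 6 = i * n ∧
        τ.reg 7 = j * n) ∧ ∀ r, r < 6 ∨ 12 < r → τ.reg r = σ.reg r)
    (fun τ => n * n - τ.reg 12) (8 * n + 10) ?_ ?_ ?_ ?_
  · refine ⟨hmem, by simp [h12], fun a ha => hz a (by omega), ⟨0, 0, ?_⟩, fun _ _ => rfl⟩
    simp [h12, h6, h7]
    exact Nat.pos_of_ne_zero
  · rintro τ ⟨hm, hB, hz', ⟨i, j, e12, hj, e6, e7⟩, hr⟩ hb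
    have hb : τ.reg 12 < τ.reg 3 := hb
    have e0 : τ.reg 0 = n := by rw [hr 0 (by simp), h0]
    have e1 : τ.reg 1 = 1 := by rw [hr 1 (by simp), h1]
    have e3 : τ.reg 3 = n * n := by rw [hr 3 (by simp), h3]
    rw [e3] at hb
    replace hj := hj hb
    have hi : i < n := by
      by_contra hi
      have := Nat.mul_le_mul_right n (not_lt.1 hi)
      omega
    have hdef := deficit_le hA n i j
    rw [show 8 * n + 10 = (8 * n + 1) + 7 + 1 + 1 by ring]
    refine Runs.const (by omega) (Runs.const (by omega)
      (Runs.seq (T₁ := 8 * n + 1) (T₂ := 7) ?_))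
    refine (runs_deficitLoop (i := i) (j := j) hA hW hi hj (by simp [e0]) (by simp [e1])
      (by simp [e6]) (by simp [e7]) (by simp) (by simp) (by simpa using hm)).mono le_rfl ?_
    rintro ρ ⟨hρm, hρ9, hρr⟩
    simp only [State.mem_setReg, State.reg_setReg] at hρm hρr
    have f0 : ρ.reg 0 = n := by simp [hρr, e0]
    have f1 : ρ.reg 1 = 1 := by simp [hρr, e1]
    have f3 : ρ.reg 3 = n * n := by simp [hρr, e3]
    have f6 : ρ.reg 6 = i * n := by simp [hρr, e6]
    have f7 : ρ.reg 7 = j * n := by simp [hρr, e7]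
    have f12 : ρ.reg 12 = i * n + j := by simp [hρr, e12]
    have hjn := Nat.mul_le_mul_right n (Nat.succ_le_of_lt hj)
    have hin := Nat.mul_le_mul_right n (Nat.succ_le_of_lt hi)
    rw [Nat.succ_mul] at hjn hin
    refine Runs.add (n * n + (i * n + j)) (by simp [f3, f12]) (by omega) ?_
    refine Runs.store (n * n + (i * n + j)) (deficit A n i j) (by simp) (by simp [hρ9])
      (by omega) (by omega) ?_
    refine Runs.add (i * n + j + 1) (by simp [f1, f12]) (by omega) ?_
    refine Runs.add (j * n + n) (by simp [f0, f7]) (by omega) ?_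
    have hm1 : ∀ a < n * n, a ≠ n * n + (i * n + j) := fun a ha => by omega
    have hm2 : ∀ a, n * n + n * n ≤ a → a ≠ n * n + (i * n + j) := fun a ha => by omega
    have hfr : ∀ r, r < 6 ∨ 12 < r → ρ.reg r = σ.reg r := by
      intro r h
      rw [hρr r (by omega) (by omega) (by omega) (by omega), if_neg (by omega),
        if_neg (by omega), hr r h]
    have hB' : ∀ i' < n, ∀ j' < n, i' * n + j' < i * n + j + 1 →
        (if i' * n + j' = i * n + j then deficit A n i j else τ.mem (n * n + (i' * n + j'))) =
        deficit A n i' j' := by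
      intro i' hi' j' hj' hlt
      split_ifs with h
      · have hii : i' = i := by
          have h' := congrArg (· / n) h
          have hn : 0 < n := by omega
          simpa [Nat.add_comm (_ * n), Nat.add_mul_div_right _ _ hn, Nat.div_eq_of_lt hj,
            Nat.div_eq_of_lt hj'] using h'
        subst hii
        obtain rfl : j' = j := by omega
        rfl
      · exact hB i' hi' j' hj' (by omega)
    refine Runs.branch (T := 2) ?_ ?_
    · intro hb
      have hb : j * n + n = n * n := by simpa [Test.Holds, f3] using hb
      have hn : 0 < n := by omega
      have hjn' : j + 1 = n := Nat.eq_of_mul_eq_mul_right hn (by rw [Nat.succ_mul]; exact hb)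
      refine Runs.const (by omega) ?_
      refine Runs.add (i * n + n) (by simp [f6, f0]) (by omega) ?_
      refine Runs.skip ⟨⟨?_, ?_, ?_, ⟨i + 1, 0, ?_⟩, ?_⟩, ?_⟩
      · intro a ha
        simp [hm1 a ha, hρm, hm a ha]
      · intro i' hi' j' hj'
        simpa [hρm] using hB' i' hi' j' hj'
      · intro a ha
        simp [hm2 a ha, hρm, hz' a ha]
      · simp [Nat.succ_mul]
        omega
      · intro r h
        have := hfr r h
        simp; rw [if_neg (by omega), if_neg (by omega), if_neg (by omega), if_neg (by omega),
          if_neg (by omega)]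
        exact this
      · simp [e12]; omega
    · intro hb
      have hb : ¬ j * n + n = n * n := by simpa [Test.Holds, f3] using hb
      have hjn' : j + 1 ≠ n := fun h => hb (by rw [← Nat.succ_mul, Nat.succ_eq_add_one, h])
      refine Runs.skip ⟨⟨?_, ?_, ?_, ⟨i, j + 1, ?_⟩, ?_⟩, ?_⟩
      · intro a ha
        simp [hm1 a ha, hρm, hm a ha]
      · intro i' hi' j' hj'
        simpa [hρm] using hB' i' hi' j' hj'
      · intro a ha
        simp [hm2 a ha, hρm, hz' a ha]
      · simp [Nat.succ_mul, f6]
        omega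
      · intro r h
        have := hfr r h
        simp; rw [if_neg (by omega), if_neg (by omega), if_neg (by omega)]
        exact this
      · simp [e12]; omega
  · simp only [h12]; simp
  · rintro τ ⟨hm, hB, hz', -, hr⟩ hb
    have hb : ¬ τ.reg 12 < τ.reg 3 := hb
    rw [hr 3 (by simp), h3] at hb
    refine ⟨fun i hi j hj => hB i hi j hj ?_, hz', hr⟩
    have := index_lt hi hj
    omega

end WordRAM

/-! ### The auction on the machine. -/

namespace NestedColouring

theorem AuctionInv.failed_le {n : ℕ} {R : ℕ → ℕ → Prop} {d m : ℕ → ℕ} {s u c : ℕ}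
    (h : AuctionInv n R d m s u c) : c ≤ n := by
  obtain ⟨F, rfl, hF, -⟩ := h.exists_failed
  refine (Finset.card_le_card fun x hx => Finset.mem_range.2 (hF x hx).1).trans ?_
  rw [Finset.card_range]

end NestedColouring

namespace WordRAM

open Program NestedColouring

/-- The order of the rows of a matrix that is computed from the deficits. -/
def rowOrder (A : ℕ → ℕ) (n u v : ℕ) : Prop :=
  deficit A n u v = 0 ∧ u < deficit A n v u * n + v

/-- If the vertex in register 16 is open to the bidder in register 13 at a lower price than that in
register 17, put its price into register 17 and its name into register 18. -/
def consider : Program :=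
  seq (add 10 19 16) <| seq (add 10 10 3) <| seq (load 10 10) <| seq (mul 11 16 0) <|
  seq (add 11 11 13) <| seq (add 11 11 3) <| seq (load 11 11) <| seq (mul 11 11 0) <|
  seq (add 11 11 16) <|
  branch (.lt 10 1)
    (branch (.lt 13 11)
      (seq (add 10 4 16) <| seq (load 10 10) <|
        branch (.lt 10 17) (seq (copy 17 10) <| seq (copy 18 16) skip) skip)
      skip)
    skip

/-- The part of the state that the search for a cheapest vertex for `u` relies on. -/
structure ScanPre (A : ℕ → ℕ) (n u : ℕ) (σ : State) : Prop where
  r0 : σ.reg 0 = n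
  r1 : σ.reg 1 = 1
  r3 : σ.reg 3 = n * n
  r4 : σ.reg 4 = n * n + n * n
  r13 : σ.reg 13 = u
  r19 : σ.reg 19 = u * n
  matrix : ∀ i < n, ∀ j < n, σ.mem (n * n + (i * n + j)) = deficit A n i j
  price_le : ∀ v < n, σ.mem (n * n + n * n + v) ≤ n

theorem ScanPre.congr {A : ℕ → ℕ} {n u : ℕ} {σ τ : State} (h : ScanPre A n u σ)
    (hm : τ.mem = σ.mem)
    (hr : ∀ r, r ≠ 10 → r ≠ 11 → r ≠ 16 → r ≠ 17 → r ≠ 18 → τ.reg r = σ.reg r) :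
    ScanPre A n u τ := by
  constructor
  · simpa [hr] using h.r0
  · simpa [hr] using h.r1
  · simpa [hr] using h.r3
  · simpa [hr] using h.r4
  · simpa [hr] using h.r13
  · simpa [hr] using h.r19
  · simpa [hm] using h.matrix
  · simpa [hm] using h.price_le

theorem runs_consider {w n u v : ℕ} {A : ℕ → ℕ} {σ : State} (hA : ∀ a, A a ≤ 1)
    (hW : 4 * (n * n) + 4 * n + 4 < 2 ^ w) (hu : u < n) (hv : v < n) (h : ScanPre A n u σ)
    (h16 : σ.reg 16 = v) :
    Runs w consider σ 16 fun τ => τ.mem = σ.mem ∧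
      (∀ r, r ≠ 10 → r ≠ 11 → r ≠ 17 → r ≠ 18 → τ.reg r = σ.reg r) ∧
      (rowOrder A n u v ∧ σ.mem (n * n + n * n + v) < σ.reg 17 ∧
          τ.reg 17 = σ.mem (n * n + n * n + v) ∧ τ.reg 18 = v ∨
        (rowOrder A n u v → σ.reg 17 ≤ σ.mem (n * n + n * n + v)) ∧
          τ.reg 17 = σ.reg 17 ∧ τ.reg 18 = σ.reg 18) := by
  have huv := index_lt hu hv
  have hvu := index_lt hv hu
  have hd := deficit_le hA n u v
  have hd' := deficit_le hA n v u
  have hdn : deficit A n v u * n ≤ n * n := Nat.mul_le_mul_right n hd'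
  have hp := h.price_le v hv
  refine Runs.add (u * n + v) (by simp [h.r19, h16]) (by omega) ?_
  refine Runs.add (n * n + (u * n + v)) (by simp [h.r3, add_comm]) (by omega) ?_
  refine Runs.load _ (deficit A n u v) (by simp; rfl) (by simp [h.matrix u hu v hv])
    (by omega) (by omega) ?_
  refine Runs.mul (v * n) (by simp [h.r0, h16]) (by omega) ?_
  refine Runs.add (v * n + u) (by simp [h.r13]) (by omega) ?_
  refine Runs.add (n * n + (v * n + u)) (by simp [h.r3, add_comm]) (by omega) ?_
  refine Runs.load _ (deficit A n v u) (by simp; rfl) (by simp [h.matrix v hv u hu])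
    (by omega) (by omega) ?_
  refine Runs.mul (deficit A n v u * n) (by simp [h.r0]) (by omega) ?_
  refine Runs.add (deficit A n v u * n + v) (by simp [h16]) (by omega) ?_
  refine Runs.branch (T := 6) ?_ ?_
  · intro hb
    have hb : deficit A n u v = 0 := by simpa [Test.Holds, h.r1] using hb
    refine Runs.branch (T := 5) ?_ ?_
    · intro hb'
      have hb' : u < deficit A n v u * n + v := by simpa [Test.Holds, h.r13] using hb'
      refine Runs.add (n * n + n * n + v) (by simp [h.r4, h16]) (by omega) ?_
      refine Runs.load _ (σ.mem (n * n + n * n + v)) (by simp; rfl) (by simp)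
        (by omega) (by omega) ?_
      refine Runs.branch (T := 2) ?_ ?_
      · intro hb''
        have hb'' : σ.mem (n * n + n * n + v) < σ.reg 17 := by simpa [Test.Holds] using hb''
        refine Runs.copy (σ.mem (n * n + n * n + v)) (by simp) (by omega) ?_
        refine Runs.copy v (by simp [h16]) (by omega) ?_
        refine Runs.skip ⟨by simp, fun r h1 h2 h3 h4 => by simp [h1, h2, h3, h4], Or.inl ?_⟩
        exact ⟨⟨hb, hb'⟩, hb'', by simp, by simp⟩
      · intro hb''
        have hb'' : σ.reg 17 ≤ σ.mem (n * n + n * n + v) := by simpa [Test.Holds] using hb''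
        refine Runs.skip ⟨by simp, fun r h1 h2 h3 h4 => by simp [h1, h2], Or.inr ?_⟩
        exact ⟨fun _ => hb'', by simp, by simp⟩
    · intro hb'
      have hb' : ¬ u < deficit A n v u * n + v := by simpa [Test.Holds, h.r13] using hb'
      refine Runs.skip ⟨by simp, fun r h1 h2 h3 h4 => by simp [h1, h2], Or.inr ?_⟩
      exact ⟨fun h' => absurd h'.2 hb', by simp, by simp⟩
  · intro hb
    have hb : deficit A n u v ≠ 0 := by simpa [Test.Holds, h.r1] using hb
    refine Runs.skip ⟨by simp, fun r h1 h2 h3 h4 => by simp [h1, h2], Or.inr ?_⟩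
    exact ⟨fun h' => absurd h'.1 hb, by simp, by simp⟩

/-- Search for a cheapest vertex open to the bidder in register 13. -/
def scan : Program :=
  loop (.lt 16 0) <| seq consider <| seq (add 16 16 1) skip

/-- The initial value `n` in register 17 is a sentinel: if it survives, every open vertex costs at
least `n` and the bidder must give up. Otherwise register 18 names a vertex attaining the minimum.
-/
theorem runs_scan {w n u : ℕ} {A : ℕ → ℕ} {σ : State} (hA : ∀ a, A a ≤ 1)
    (hW : 4 * (n * n) + 4 * n + 4 < 2 ^ w) (hu : u < n) (h : ScanPre A n u σ)
    (h16 : σ.reg 16 = 0) (h17 : σ.reg 17 = n) :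
    Runs w scan σ (18 * n + 1) fun τ => τ.mem = σ.mem ∧
      (∀ r, r ≠ 10 → r ≠ 11 → r ≠ 16 → r ≠ 17 → r ≠ 18 → τ.reg r = σ.reg r) ∧
      (∀ v < n, rowOrder A n u v → τ.reg 17 ≤ σ.mem (n * n + n * n + v)) ∧
      (τ.reg 17 < n → τ.reg 18 < n ∧ rowOrder A n u (τ.reg 18) ∧
        σ.mem (n * n + n * n + τ.reg 18) = τ.reg 17) ∧ τ.reg 17 ≤ n := by
  refine Runs.loop (fun τ => τ.mem = σ.mem ∧
      (∀ r, r ≠ 10 → r ≠ 11 → r ≠ 16 → r ≠ 17 → r ≠ 18 → τ.reg r = σ.reg r) ∧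
      (∀ v < τ.reg 16, rowOrder A n u v → τ.reg 17 ≤ σ.mem (n * n + n * n + v)) ∧
      (τ.reg 17 < n → τ.reg 18 < n ∧ rowOrder A n u (τ.reg 18) ∧
        σ.mem (n * n + n * n + τ.reg 18) = τ.reg 17) ∧ τ.reg 17 ≤ n ∧ τ.reg 16 ≤ n)
    (fun τ => n - τ.reg 16) 17 ?_ ?_ ?_ ?_
  · exact ⟨rfl, fun _ _ _ _ _ _ => rfl, by simp [h16], by simp [h17], h17.le, by simp [h16]⟩
  · rintro τ ⟨hm, hr, hlow, hat, h17n, h16n⟩ hb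
    have hτ := h.congr hm hr
    have hb : τ.reg 16 < τ.reg 0 := hb
    rw [hτ.r0] at hb
    refine Runs.seq (T₁ := 16) (T₂ := 1) ((runs_consider hA hW hu hb hτ rfl).mono le_rfl ?_)
    rintro ρ ⟨hρm, hρr, hρ⟩
    rw [hm] at hρ hρm
    have h1 : ρ.reg 1 = 1 := by simp [hρr, hτ.r1]
    have hv : ρ.reg 16 = τ.reg 16 := by simp [hρr]
    refine Runs.add (τ.reg 16 + 1) (by rw [h1, hv]) (by omega) ?_
    refine Runs.skip ⟨⟨by simpa using hρm, ?_, ?_, ?_, ?_, by simp; omega⟩, by simp; omega⟩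
    · intro r r10 r11 r16 r17 r18
      simp [r16, hρr, r10, r11, r17, r18, hr]
    · simp only [State.reg_setReg, if_true]
      rw [if_neg (by simp)]
      intro v hvk hR
      rcases Nat.lt_succ_iff_lt_or_eq.1 hvk with hlt | rfl
      · have := hlow v hlt hR
        rcases hρ with ⟨_, _, _, _⟩ | ⟨_, _, _⟩ <;> omega
      · rcases hρ with ⟨_, _, _, _⟩ | ⟨hle, _, _⟩
        · omega
        · have := hle hR
          omega
    · simp only [State.reg_setReg]
      rw [if_neg (by simp), if_neg (by simp)]
      rcases hρ with ⟨hR, h2, h3, h4⟩ | ⟨_, h3, h4⟩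
      · intro _
        rw [h4, h3]
        exact ⟨hb, hR, rfl⟩
      · rw [h4, h3]
        exact hat
    · simp only [State.reg_setReg]
      rw [if_neg (by simp)]
      rcases hρ with ⟨_, _, _, _⟩ | ⟨_, _, _⟩ <;> omega
  · simp only [h16]; omega
  · rintro τ ⟨hm, hr, hlow, hat, h17n, h16n⟩ hb
    have hb : ¬ τ.reg 16 < τ.reg 0 := hb
    rw [(h.congr hm hr).r0] at hb
    exact ⟨hm, hr, fun v hv => hlow v (by omega), hat, h17n⟩

/-- The auction. Register 13 holds the current bidder, register 14 the number of bidders that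
entered before the last one, and register 15 the number of bidders that gave up. -/
def auction : Program :=
  loop (.lt 14 0) <|
    seq (mul 19 13 0) <| seq (const 16 0) <| seq (copy 17 0) <| seq (const 18 0) <| seq scan <|
    branch (.lt 17 0)
      (seq (add 17 17 1) <| seq (add 10 4 18) <| seq (store 10 17) <| seq (add 10 5 18) <|
        seq (load 11 10) <| seq (add 13 13 1) <| seq (store 10 13) <|
        branch (.lt 11 1) (seq (add 14 14 1) <| seq (copy 13 14) skip) (seq (sub 13 11 1) skip))
      (seq (add 15 15 1) <| seq (add 14 14 1) <| seq (copy 13 14) skip)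

/-- The auction invariant, read off a state of the machine. -/
def AuctionState (A : ℕ → ℕ) (n : ℕ) (τ : State) : Prop :=
  AuctionInv n (rowOrder A n) (fun v => τ.mem (n * n + n * n + v))
    (fun v => τ.mem (n * n + n * n + n + v)) (τ.reg 14) (τ.reg 13) (τ.reg 15)

/-- Every round raises a price or admits a new bidder, so `auctionPotential`, at most `n * n + n` at
the start, serves as the variant. The zeroed memory behind the deficits supplies the initial prices
and the empty holders. -/
theorem runs_auction {w n : ℕ} {A : ℕ → ℕ} {σ : State} (hA : ∀ a, A a ≤ 1)
    (hW : 4 * (n * n) + 4 * n + 4 < 2 ^ w)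
    (h0 : σ.reg 0 = n) (h1 : σ.reg 1 = 1) (h3 : σ.reg 3 = n * n)
    (h4 : σ.reg 4 = n * n + n * n) (h5 : σ.reg 5 = n * n + n * n + n)
    (h13 : σ.reg 13 = 0) (h14 : σ.reg 14 = 0) (h15 : σ.reg 15 = 0)
    (hB : ∀ i < n, ∀ j < n, σ.mem (n * n + (i * n + j)) = deficit A n i j)
    (hz : ∀ a, n * n + n * n ≤ a → σ.mem a = 0) :
    Runs w auction σ ((n * n + n) * (18 * n + 17) + 1) fun τ =>
      AuctionState A n τ ∧ τ.reg 14 = n := by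
  refine Runs.loop (fun τ => AuctionState A n τ ∧
      (∀ i < n, ∀ j < n, τ.mem (n * n + (i * n + j)) = deficit A n i j) ∧
      ∀ r, r < 6 → τ.reg r = σ.reg r)
    (fun τ => auctionPotential n (fun v => τ.mem (n * n + n * n + v)) (τ.reg 14))
    (18 * n + 16) ⟨?_, hB, fun _ _ => rfl⟩ ?_ ?_ ?_
  · have e1 : (fun v => σ.mem (n * n + n * n + v)) = fun _ => 0 :=
      funext fun v => hz _ (by omega)
    have e2 : (fun v => σ.mem (n * n + n * n + n + v)) = fun _ => 0 :=
      funext fun v => hz _ (by omega)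
    rw [AuctionState, e1, e2, h13, h14, h15]
    exact AuctionInv.init n _
  · rintro τ ⟨hinv, hm, hr⟩ hb
    unfold AuctionState at hinv
    have e0 : τ.reg 0 = n := by rw [hr 0 (by simp), h0]
    have e1 : τ.reg 1 = 1 := by rw [hr 1 (by simp), h1]
    have e3 : τ.reg 3 = n * n := by rw [hr 3 (by simp), h3]
    have e4 : τ.reg 4 = n * n + n * n := by rw [hr 4 (by simp), h4]
    have e5 : τ.reg 5 = n * n + n * n + n := by rw [hr 5 (by simp), h5]
    have hb : τ.reg 14 < τ.reg 0 := hb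
    rw [e0] at hb
    obtain ⟨u, e13⟩ : ∃ u, τ.reg 13 = u := ⟨_, rfl⟩
    obtain ⟨s, e14⟩ : ∃ s, τ.reg 14 = s := ⟨_, rfl⟩
    obtain ⟨c, e15⟩ : ∃ c, τ.reg 15 = c := ⟨_, rfl⟩
    rw [e13, e14, e15] at hinv
    rw [e14] at hb ⊢
    have hu : u < n := lt_of_le_of_lt hinv.u_le hb
    have hc := hinv.failed_le
    have hun : u * n ≤ n * n := Nat.mul_le_mul_right n hu.le
    refine Runs.mul (u * n) (by simp [e0, e13]) (by omega) ?_
    refine Runs.const (by omega) ?_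
    refine Runs.copy n (by simp [e0]) (by omega) ?_
    refine Runs.const (by omega) ?_
    refine Runs.seq (T₁ := 18 * n + 1) (T₂ := 11) ?_
    refine (runs_scan (u := u) hA hW hu ?_ (by simp) (by simp)).mono le_rfl ?_
    · exact ⟨by simp [e0], by simp [e1], by simp [e3], by simp [e4], by simp [e13], by simp,
        by simpa using hm, by simpa using hinv.price_le⟩
    rintro ρ ⟨hρm, hρr, hlow, hat, h17n⟩
    simp only [State.mem_setReg, State.reg_setReg] at hρm hρr hlow hat
    have f0 : ρ.reg 0 = n := by simp [hρr, e0]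
    have f1 : ρ.reg 1 = 1 := by simp [hρr, e1]
    have f4 : ρ.reg 4 = n * n + n * n := by simp [hρr, e4]
    have f5 : ρ.reg 5 = n * n + n * n + n := by simp [hρr, e5]
    have f13 : ρ.reg 13 = u := by simp [hρr, e13]
    have f14 : ρ.reg 14 = s := by simp [hρr, e14]
    have f15 : ρ.reg 15 = c := by simp [hρr, e15]
    have hfr : ∀ r, r < 6 → ρ.reg r = σ.reg r := by
      intro r h
      rw [hρr r (by omega) (by omega) (by omega) (by omega) (by omega), if_neg (by omega),
        if_neg (by omega), if_neg (by omega), if_neg (by omega), hr r h]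
    obtain ⟨b, f17⟩ : ∃ b, ρ.reg 17 = b := ⟨_, rfl⟩
    obtain ⟨v, f18⟩ : ∃ v, ρ.reg 18 = v := ⟨_, rfl⟩
    rw [f17] at hlow hat h17n
    rw [f18] at hat
    refine Runs.branch (T := 10) ?_ ?_
    · intro hbn
      have hbn : b < n := by simpa [Test.Holds, f17, f0] using hbn
      obtain ⟨hv, hR, hbv⟩ := hat hbn
      subst hbv
      -- A holder's name is stored shifted by one, so the entry is at most `n` and fits into a word.
      have hmv : τ.mem (n * n + n * n + n + v) ≤ n := by
        rcases Nat.eq_zero_or_pos (τ.mem (n * n + n * n + n + v)) with h | h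
        · omega
        · have := (hinv.rel v hv (τ.mem (n * n + n * n + n + v) - 1)
            (show τ.mem (n * n + n * n + n + v) = _ by omega)).1
          omega
      refine Runs.add (τ.mem (n * n + n * n + v) + 1) (by simp [f17, f1]) (by omega) ?_
      refine Runs.add (n * n + n * n + v) (by simp [f18, f4]) (by omega) ?_
      refine Runs.store (n * n + n * n + v) (τ.mem (n * n + n * n + v) + 1) (by simp) (by simp)
        (by omega) (by omega) ?_
      refine Runs.add (n * n + n * n + n + v) (by simp [f18, f5]) (by omega) ?_
      refine Runs.load (n * n + n * n + n + v) (τ.mem (n * n + n * n + n + v)) (by simp)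
        (by simp [hρm]; omega) (by omega) (by omega) ?_
      refine Runs.add (u + 1) (by simp [f13, f1]) (by omega) ?_
      refine Runs.store (n * n + n * n + n + v) (u + 1) (by simp) (by simp)
        (by omega) (by omega) ?_
      -- Prices and holders occupy disjoint blocks, so the two writes do not interfere; nor do they
      -- touch the deficits.
      have hd' : ∀ x < n, (if n * n + n * n + x = n * n + n * n + n + v then u + 1 else
          if n * n + n * n + x = n * n + n * n + v then τ.mem (n * n + n * n + v) + 1 else
          τ.mem (n * n + n * n + x)) =
          if x = v then τ.mem (n * n + n * n + v) + 1 else τ.mem (n * n + n * n + x) := by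
        intro x hx
        rw [if_neg (by omega)]
        simp
      have hm' : ∀ x < n, (if n * n + n * n + n + x = n * n + n * n + n + v then u + 1 else
          if n * n + n * n + n + x = n * n + n * n + v then τ.mem (n * n + n * n + v) + 1 else
          τ.mem (n * n + n * n + n + x)) =
          if x = v then u + 1 else τ.mem (n * n + n * n + n + x) := by
        intro x hx
        rw [if_neg (c := n * n + n * n + n + x = n * n + n * n + v) (by omega)]
        simp
      have hB' : ∀ i < n, ∀ j < n, (if n * n + (i * n + j) = n * n + n * n + n + v then u + 1 else
          if n * n + (i * n + j) = n * n + n * n + v then τ.mem (n * n + n * n + v) + 1 else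
          τ.mem (n * n + (i * n + j))) = deficit A n i j := by
        intro i hi j hj
        have := index_lt hi hj
        rw [if_neg (by omega), if_neg (by omega), hm i hi j hj]
      refine Runs.branch (T := 2) ?_ ?_
      · intro hfree
        have hfree : τ.mem (n * n + n * n + n + v) = 0 := by simpa [Test.Holds, f1] using hfree
        refine Runs.add (s + 1) (by simp [f14, f1]) (by omega) ?_
        refine Runs.copy (s + 1) (by simp) (by omega) ?_
        refine Runs.skip ⟨⟨?_, by simpa [hρm] using hB', ?_⟩, ?_⟩
        · simp only [AuctionState, State.mem_setReg, State.mem_setMem, State.reg_setReg,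
            State.reg_setMem, hρm, f15]
          simp only [if_true, Nat.reduceEqDiff, if_false]
          exact hinv.bid hb hv hR hbn hlow hd' hm' (Or.inl ⟨hfree, rfl, rfl⟩)
        · intro r h
          simp; repeat rw [if_neg (by omega)]
          exact hfr r h
        · simp only [State.mem_setReg, State.mem_setMem, State.reg_setReg, State.reg_setMem, hρm]
          simp only [if_true, Nat.reduceEqDiff, if_false]
          exact auctionPotential_lt_of_bid (Nat.le_succ s) hv hbn hd'
      · intro hheld
        have hheld : τ.mem (n * n + n * n + n + v) ≠ 0 := by simpa [Test.Holds, f1] using hheld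
        refine Runs.sub (τ.mem (n * n + n * n + n + v) - 1) (by simp [f1]) (by omega) ?_
        refine Runs.skip ⟨⟨?_, by simpa [hρm] using hB', ?_⟩, ?_⟩
        · simp only [AuctionState, State.mem_setReg, State.mem_setMem, State.reg_setReg,
            State.reg_setMem, hρm, f15, f14]
          simp only [if_true, Nat.reduceEqDiff, if_false]
          refine hinv.bid hb hv hR hbn hlow hd' hm' (Or.inr ⟨?_, rfl⟩)
          show τ.mem (n * n + n * n + n + v) = _
          omega
        · intro r h
          simp; repeat rw [if_neg (by omega)]
          exact hfr r h
        · simp only [State.mem_setReg, State.mem_setMem, State.reg_setReg, State.reg_setMem, hρm,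
            f14]
          simp only [Nat.reduceEqDiff, if_false]
          exact auctionPotential_lt_of_bid le_rfl hv hbn hd'
    · intro hbn
      have hbn : n ≤ b := by simpa [Test.Holds, f17, f0] using hbn
      refine Runs.add (c + 1) (by simp [f15, f1]) (by omega) ?_
      refine Runs.add (s + 1) (by simp [f14, f1]) (by omega) ?_
      refine Runs.copy (s + 1) (by simp) (by omega) ?_
      refine Runs.skip ⟨⟨?_, by simpa [hρm] using hm, ?_⟩, ?_⟩
      · simp only [AuctionState, State.mem_setReg, State.reg_setReg, hρm]
        simp only [if_true, Nat.reduceEqDiff, if_false]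
        exact hinv.fail hb fun x hx hux => hbn.trans (hlow x hx hux)
      · intro r h
        simp; repeat rw [if_neg (by omega)]
        exact hfr r h
      · simp only [State.mem_setReg, State.reg_setReg, hρm]
        simp only [if_true, Nat.reduceEqDiff, if_false]
        unfold auctionPotential
        omega
  · have : auctionPotential n (fun v => σ.mem (n * n + n * n + v)) (σ.reg 14) ≤ n * n + n := by
      unfold auctionPotential
      refine Nat.add_le_add ?_ (Nat.sub_le _ _)
      refine (Finset.sum_le_card_nsmul _ _ n fun v _ => Nat.sub_le _ _).trans (by simp)
    exact Nat.add_le_add_right (Nat.mul_le_mul_right _ this) 1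
  · rintro τ ⟨hinv, hm, hr⟩ hb
    have hb : ¬ τ.reg 14 < τ.reg 0 := hb
    rw [hr 0 (by simp), h0] at hb
    have := hinv.s_le
    exact ⟨hinv, by omega⟩

/-! ### The complete program, its correctness and its cubic bound. -/

/-- The program that computes the nested chromatic number. -/
def nestedChromaticProgram : Program :=
  seq (const 1 1) <| seq (mul 3 0 0) <| seq deficitMatrix <|
  seq (add 4 3 3) <| seq (add 5 4 0) <| seq auction <| seq (copy 0 15) skip

/-- A bound for the running time of `nestedChromaticProgram`. -/
def nestedChromaticTime (n : ℕ) : ℕ :=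
  n * n * (8 * n + 11) + 1 + ((n * n + n) * (18 * n + 17) + 1 + 1 + 1 + 1) + 1 + 1

theorem runs_nestedChromaticProgram {w n : ℕ} {σ : State} (hA : ∀ a, σ.mem a ≤ 1)
    (hW : 4 * (n * n) + 4 * n + 4 < 2 ^ w) (h0 : σ.reg 0 = n) (hr : ∀ r, r ≠ 0 → σ.reg r = 0)
    (hz : ∀ a, n * n ≤ a → σ.mem a = 0) :
    Runs w nestedChromaticProgram σ (nestedChromaticTime n) fun τ =>
      ∃ d m u, AuctionInv n (rowOrder σ.mem n) d m n u (τ.reg 0) := by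
  refine Runs.const (by omega) ?_
  refine Runs.mul (n * n) (by simp [h0]) (by omega) ?_
  refine Runs.seq (T₁ := n * n * (8 * n + 11) + 1)
    (T₂ := (n * n + n) * (18 * n + 17) + 1 + 1 + 1 + 1) ?_
  refine (runs_deficitMatrix (n := n) hA hW (by simp [h0]) (by simp) (by simp) (by simp [hr])
    (by simp [hr]) (by simp [hr]) (by simp) (by simpa using hz)).mono le_rfl ?_
  rintro ρ ⟨hB, hz', hρ⟩
  simp only [State.reg_setReg] at hρ
  have f0 : ρ.reg 0 = n := by simp [hρ, h0]
  have f1 : ρ.reg 1 = 1 := by simp [hρ]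
  have f3 : ρ.reg 3 = n * n := by simp [hρ]
  refine Runs.add (n * n + n * n) (by simp [f3]) (by omega) ?_
  refine Runs.add (n * n + n * n + n) (by simp [f0]) (by omega) ?_
  refine Runs.seq (T₁ := (n * n + n) * (18 * n + 17) + 1) (T₂ := 1) ?_
  refine (runs_auction hA hW (by simp [f0]) (by simp [f1]) (by simp [f3]) (by simp) (by simp)
    (by simp [hρ, hr]) (by simp [hρ, hr]) (by simp [hρ, hr]) (by simpa using hB)
    (by simpa using hz')).mono le_rfl ?_
  rintro τ ⟨hinv, h14⟩
  unfold AuctionState at hinv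
  rw [h14] at hinv
  have hc := hinv.failed_le
  refine Runs.copy (τ.reg 15) rfl (by omega) ?_
  exact Runs.skip ⟨_, _, _, hinv⟩

theorem graphInput_mem_le {n : ℕ} (G : SimpleGraph (Fin n)) (a : ℕ) :
    (graphInput G).mem a ≤ 1 := by
  simp only [graphInput]
  split_ifs <;> simp

theorem graphInput_mem_eq_zero {n : ℕ} (G : SimpleGraph (Fin n)) {a : ℕ} (ha : n * n ≤ a) :
    (graphInput G).mem a = 0 := by
  simp only [graphInput]
  rw [if_neg]
  rintro ⟨i, j, rfl, -⟩
  have := index_lt i.2 j.2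
  omega

theorem graphInput_mem_index {n : ℕ} (G : SimpleGraph (Fin n)) (i j : Fin n) :
    (graphInput G).mem (i * n + j) = 1 ↔ G.Adj i j := by
  simp only [graphInput, ite_eq_left_iff, zero_ne_one, imp_false, not_not]
  constructor
  · rintro ⟨i', j', h, hadj⟩
    have hn : 0 < n := i.pos
    have hi : i = i' := by
      have h' := congrArg (· / n) h
      apply Fin.ext
      simpa [Nat.add_comm (_ * n), Nat.add_mul_div_right _ _ hn, Nat.div_eq_of_lt j.2,
        Nat.div_eq_of_lt j'.2] using h'
    subst hi
    obtain rfl : j = j' := Fin.ext (by omega)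
    exact hadj
  · exact fun h => ⟨i, j, rfl, h⟩

/-- Truncated subtraction of two bits vanishes exactly when the first bit implies the second. -/
theorem deficit_eq_zero_iff {n : ℕ} (G : SimpleGraph (Fin n)) (i j : Fin n) :
    deficit (graphInput G).mem n i j = 0 ↔ IsWeakDuplicate G i j := by
  have key : ∀ k : Fin n,
      (graphInput G).mem (i * n + k) - (graphInput G).mem (j * n + k) = 0 ↔
        (G.Adj i k → G.Adj j k) := by
    intro k
    rw [← graphInput_mem_index, ← graphInput_mem_index]
    have h1 := graphInput_mem_le G (i * n + k)
    have h2 := graphInput_mem_le G (j * n + k)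
    omega
  rw [deficit, Finset.sum_eq_zero_iff]
  constructor
  · intro h k hk
    exact (key k).1 (h k (Finset.mem_range.2 k.2)) hk
  · intro h k hk
    exact (key ⟨k, Finset.mem_range.1 hk⟩).2 fun h' => h h'

/-- A nonzero deficit contributes at least `n > u`, making the comparison automatic, and a zero
deficit leaves `u < v`. Thus one arithmetic test encodes the disjunction in the tie-break. -/
theorem rowOrder_graphInput {n : ℕ} (G : SimpleGraph (Fin n)) (u v : Fin n) :
    rowOrder (graphInput G).mem n u v ↔ nestedOrder G u v := by
  rw [rowOrder, nestedOrder, deficit_eq_zero_iff, ← deficit_eq_zero_iff G v u]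
  refine and_congr_right fun _ => ?_
  rcases Nat.eq_zero_or_pos (deficit (graphInput G).mem n v u) with h | h
  · simp [h]
  · have h1 := Nat.mul_le_mul_right n h
    have h2 := u.2
    simp only [h.ne', not_false_eq_true, true_or, iff_true]
    omega

/-- Of the eight factors `2 ^ (Nat.log 2 n + 1)`, two dominate `(n + 1) ^ 2`, and the other six,
each at least `2`, absorb the constant, also for small `n`. -/
theorem word_bound (n : ℕ) : 4 * (n * n) + 4 * n + 4 < 2 ^ (8 * (Nat.log 2 n + 1)) := by
  have h1 : n + 1 ≤ 2 ^ (Nat.log 2 n + 1) := Nat.lt_pow_succ_log_self one_lt_two n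
  have h2 : 2 ≤ 2 ^ (Nat.log 2 n + 1) := by
    rw [pow_succ]
    have := Nat.one_le_two_pow (n := Nat.log 2 n)
    omega
  rw [mul_comm 8, pow_mul]
  generalize 2 ^ (Nat.log 2 n + 1) = x at *
  have h3 : (n + 1) ^ 2 ≤ x ^ 2 := Nat.pow_le_pow_left h1 2
  have h4 : 2 ^ 6 ≤ x ^ 6 := Nat.pow_le_pow_left h2 6
  calc 4 * (n * n) + 4 * n + 4 < 2 ^ 6 * (n + 1) ^ 2 := by nlinarith
    _ ≤ x ^ 6 * x ^ 2 := Nat.mul_le_mul h4 h3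
    _ = x ^ 8 := by ring

theorem nestedChromaticTime_isBigO :
    (fun n : ℕ => (nestedChromaticTime n : ℝ)) =O[Filter.atTop] fun n : ℕ => (n : ℝ) ^ 3 := by
  -- The coefficients of the time bound, expanded as a polynomial in `n`, add up to 96.
  refine Asymptotics.IsBigO.of_bound 100 (Filter.eventually_atTop.2 ⟨1, fun n hn => ?_⟩)
  have h : nestedChromaticTime n ≤ 100 * n ^ 3 := by
    have h1 : n ≤ n ^ 3 := Nat.le_self_pow (by simp) n
    have h2 : n ^ 2 ≤ n ^ 3 := Nat.pow_le_pow_right hn (by simp)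
    unfold nestedChromaticTime
    ring_nf
    omega
  rw [Real.norm_of_nonneg (by positivity), Real.norm_of_nonneg (by positivity)]
  exact_mod_cast h

end WordRAM

theorem mainTheorem2 :
    ∃ T : ℕ → ℕ,
      (fun n : ℕ => (T n : ℝ)) =O[Filter.atTop] (fun n : ℕ => (n : ℝ) ^ 3) ∧
      WordRAM.ComputableInTime
        (fun (n : ℕ) (G : SimpleGraph (Fin n)) => NestedColouring.nestedChromaticNumber G) T := by
  refine ⟨_, WordRAM.nestedChromaticTime_isBigO, WordRAM.nestedChromaticProgram, 8, fun n G => ?_⟩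
  obtain ⟨t, τ, ht, he, d, m, u, hinv⟩ := WordRAM.runs_nestedChromaticProgram
    (σ := WordRAM.graphInput G) (WordRAM.graphInput_mem_le G) (WordRAM.word_bound n)
    (by simp [WordRAM.graphInput]) (fun r hr => by simp [WordRAM.graphInput, hr])
    (fun a ha => WordRAM.graphInput_mem_eq_zero G ha)
  exact ⟨t, τ, ht, he, (hinv.nestedChromaticNumber_eq (WordRAM.rowOrder_graphInput G)).symm⟩
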